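/- Let $0<\alpha<1$ and let $C_0^\infty(\mathbb R)$ be the space of smooth compactly supported real functions on $\mathbb R$. For $\varphi\in C_0^\infty(\mathbb R)$ the classical left and right fractional derivatives of order $\alpha$ are $$ {}^{-}D^{\alpha}\varphi(x)=\frac{1}{\Gamma(1-\alpha)}\frac{d}{dx}\int_{-\infty}^{x}\frac{\varphi(y)}{(x-y)^{\alpha}}\,dy,\qquad {}^{+}D^{\alpha}\varphi(x)=-\frac{1}{\Gamma(1-\alpha)}\frac{d}{dx}\int_{x}^{\infty}\frac{\varphi(y)}{(y-x)^{\alpha}}\,dy . $$ For $u\in L^p(\mathbb R)$ with $1\le p<\infty$, a function $v\in L^1_{loc}(\mathbb R)$ is called the weak fractional derivative of order $\alpha$ of $u$, written $v={}^{\pm}\mathcal D^{\alpha}u$ (with upper signs for the right and lower signs for the left derivative), if $$ \int_{\mathbb R} v\,\varphi\,dx=\int_{\mathbb R}u\;{}^{\mp}D^{\alpha}\varphi\,dx\qquad\text{for all }\varphi\in C_0^\infty(\mathbb R). $$ Theorem. Let $0<\alpha<1$, $1\le p<\infty$, $1\le q<\infty$, let $u\in L^p(\mathbb R)$, let $v:\mathbb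 R\to\mathbb R$ be a function, and fix one of the two signs $\pm$. (a) The weak fractional derivative ${}^{\pm}\mathcal D^{\alpha}u$ exists, equals $v$, and belongs to $L^q_{loc}(\mathbb R)$ if and only if there is a sequence $(u_j)_{j\ge1}\subset C_0^\infty(\mathbb R)$ such that, as $j\to\infty$, $u_j\to u$ in $L^p(\mathbb R)$ and ${}^{\pm}\mathcal D^{\alpha}u_j\to v$ in $L^q_{loc}(\mathbb R)$ (that is, ${}^{\pm}\mathcal D^{\alpha}u_j$ and $v$ belong to $L^q_{loc}(\mathbb R)$ and $\|{}^{\pm}\mathcal D^{\alpha}u_j-v\|_{L^q(K)}\to0$ for every compact $K\subset\mathbb R$). The case $p=q=1$ is included. (b) Suppose $v={}^{\pm}\mathcal D^{\alpha}u\in L^q_{loc}(\mathbb R)$. Let $\psi\in C^\infty(\mathbb R)$ be any function with $\psi(t)=1$ for $t\le0$ and $\psi(t)=0$ for $t\ge1$, put $\psi_j(x)=\psi(|x|-j)$, and let $\eta_\varepsilon(x)=\varepsilon^{-1}\eta(x/\varepsilon)$, where $\eta$ is the standard mollifier, $\eta(x)=c\,e^{1/(x^2-1)}$ for $|x|<1$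 and $\eta(x)=0$ for $|x|\ge1$, with $c>0$ such that $\int_{\mathbb R}\eta\,dx=1$. Then the functions $$ u_j=\eta_{1/j}*(\psi_j u),\qquad j=1,2,3,\dots, $$ belong to $C_0^\infty(\mathbb R)$, their weak fractional derivatives ${}^{\pm}\mathcal D^{\alpha}u_j$ exist, and $u_j\to u$ in $L^p(\mathbb R)$ and ${}^{\pm}\mathcal D^{\alpha}u_j\to v$ in $L^q_{loc}(\mathbb R)$ as $j\to\infty$. -/

import Mathlib

open MeasureTheory Filter Topology Set
open scoped ENNReal ContDiff

noncomputable section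

namespace FracCalc

/-- The two directions of one-dimensional fractional calculus; `left` corresponds to the
superscript `-` (integration over `(-∞, x)`) and `right` to `+` (integration over `(x, ∞)`). -/
inductive Side where
  | left : Side
  | right : Side

/-- The opposite direction. -/
def Side.opp : Side → Side
  | .left => .right
  | .right => .left

/-- The left and right Liouville fractional integrals of order `σ > 0` on the real line,
`Γ(σ)⁻¹ ∫_{-∞}^x f(y) (x - y)^{σ - 1} dy` and `Γ(σ)⁻¹ ∫_x^∞ f(y) (y - x)^{σ - 1} dy`. -/
def fracIntegral (s : Side) (σ : ℝ) (f : ℝ → ℝ) (x : ℝ) : ℝ :=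
  match s with
  | .left => (Real.Gamma σ)⁻¹ * ∫ y in Iio x, f y / (x - y) ^ (1 - σ)
  | .right => (Real.Gamma σ)⁻¹ * ∫ y in Ioi x, f y / (y - x) ^ (1 - σ)

/-- The left and right classical (Liouville) fractional derivatives on the real line, for an
order `α` with `0 < α < 1`: `d/dx` of the left fractional integral of order `1 - α`, and
`- d/dx` of the right one. -/
def fracDeriv (s : Side) (α : ℝ) (f : ℝ → ℝ) (x : ℝ) : ℝ :=
  match s with
  | .left => deriv (fracIntegral .left (1 - α) f) x
  | .right => -deriv (fracIntegral .right (1 - α) f) x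

/-- `φ ∈ C_0^∞(ℝ)`. -/
def IsTestFunction (φ : ℝ → ℝ) : Prop :=
  ContDiff ℝ ∞ φ ∧ HasCompactSupport φ

/-- `f ∈ L^q_loc(ℝ)`. -/
def MemLpLoc (f : ℝ → ℝ) (q : ℝ≥0∞) : Prop :=
  ∀ K : Set ℝ, IsCompact K → MemLp f q (volume.restrict K)

/-- `F j → f` in `L^q_loc(ℝ)` as `j → ∞`. -/
def TendstoLpLoc (F : ℕ → ℝ → ℝ) (f : ℝ → ℝ) (q : ℝ≥0∞) : Prop :=
  (∀ j, MemLpLoc (F j) q) ∧ MemLpLoc f q ∧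
    ∀ K : Set ℝ, IsCompact K →
      Tendsto (fun j => eLpNorm (F j - f) q (volume.restrict K)) atTop (𝓝 0)

/-- `v` is the left (right) weak fractional derivative of order `α` of `u` on the real line,
for `0 < α < 1` (so that the sign `(-1)^[α]` is `1`): `v` is locally integrable and
`∫ v φ = ∫ u D^α φ` for every test function `φ`, with the classical fractional derivative of the
opposite direction. The right-hand integrand is integrable for every `u` in a space `L^p(ℝ)`,
because `D^α φ` is bounded and integrable. -/
def IsWeakFracDeriv (s : Side) (α : ℝ) (u v : ℝ → ℝ) : Prop :=
  LocallyIntegrable v volume ∧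
    ∀ φ : ℝ → ℝ, IsTestFunction φ →
      ∫ x, v x * φ x = ∫ x, u x * fracDeriv s.opp α φ x

/-- The standard mollifier: `exp (1 / (x ^ 2 - 1))` for `|x| < 1`, and `0` otherwise, normalized
to have integral one. -/
def stdMollifier (x : ℝ) : ℝ :=
  expNegInvGlue (1 - x ^ 2) / ∫ y : ℝ, expNegInvGlue (1 - y ^ 2)

/-- The rescaled mollifier `η_ε(x) = ε⁻¹ η(x / ε)`. -/
def mollifier (ε : ℝ) (x : ℝ) : ℝ :=
  ε⁻¹ * stdMollifier (x / ε)

/-- The profile of a cutoff: a smooth function equal to `1` on `(-∞, 0]` and to `0` on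
`[1, ∞)`. -/
def IsCutoffProfile (ψ : ℝ → ℝ) : Prop :=
  ContDiff ℝ ∞ ψ ∧ (∀ t, t ≤ 0 → ψ t = 1) ∧ ∀ t, 1 ≤ t → ψ t = 0

/-- The mollified cutoff `η_{1/j} * (ψ_j u)` with `ψ_j(x) = ψ(|x| - j)`. -/
def mollifiedCutoff (ψ u : ℝ → ℝ) (j : ℕ) : ℝ → ℝ :=
  convolution (mollifier (1 / (j : ℝ))) (fun x => ψ (|x| - (j : ℝ)) * u x)
    (ContinuousLinearMap.lsmul ℝ ℝ) volume

end FracCalc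

end

/-! For a test function, `fracDeriv s α φ` is the convolution of `φ'` with a locally integrable
power kernel. Away from the support of `φ` one integrates by parts onto the kernel, so the
derivative decays like `|x|^(-1-α)` and lies in every `L^r`, `1 ≤ r ≤ ∞` (`abs_fracDeriv_le`,
`memLp_fracDeriv`). It can thus be paired with any `u` in `L^p`.

If approximants converge, Hölder's inequality passes both sides of the defining identity to the
limit (`isWeakFracDeriv_of_tendsto`).

For the converse and for (b), write `η` for the mollifier of radius `1/j`. Then `D^α u_j` is the
convolution of `ψ_j u` with `D^α η`, while testing the definition with translates of the reflected
`η` shows that `η ⋆ v` is the convolution of `u` with `D^α η`. Their difference at `x` is the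
integral of `(ψ_j u - u)(y) (D^α η)(x - y)`. The first factor vanishes for `|y| ≤ j`, so for `x` in
a compact set only the tail of `D^α η` enters. That tail is controlled by `∫ η = 1`, hence uniformly
in the radius, and Hölder makes the difference uniformly small
(`abs_fracDeriv_mollifiedCutoff_sub_le`). Finally `η ⋆ v → v` in `L^q_loc`. -/

open scoped Convolution

namespace FracCalc

/-! ### The power kernel of the fractional derivative -/

section Kernel

/-- The convolution kernel of the Liouville derivative: `fracDeriv s α φ = φ' ⋆ fracKernel s α`. -/
noncomputable def fracKernel (s : Side) (α : ℝ) (t : ℝ) : ℝ :=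
  match s with
  | .left => (Ioi (0 : ℝ)).indicator (fun r => (Real.Gamma (1 - α))⁻¹ * r ^ (-α)) t
  | .right => -(Ioi (0 : ℝ)).indicator (fun r => (Real.Gamma (1 - α))⁻¹ * r ^ (-α)) (-t)

/-- The derivative of `fracKernel` away from the origin. -/
noncomputable def fracKernelDeriv (s : Side) (α : ℝ) (t : ℝ) : ℝ :=
  match s with
  | .left => (Ioi (0 : ℝ)).indicator
      (fun r => (Real.Gamma (1 - α))⁻¹ * (-α * r ^ (-α - 1))) t
  | .right => (Ioi (0 : ℝ)).indicator
      (fun r => (Real.Gamma (1 - α))⁻¹ * (-α * r ^ (-α - 1))) (-t)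

theorem fracKernel_opp (s : Side) (α t : ℝ) :
    fracKernel s.opp α t = -fracKernel s α (-t) := by
  cases s <;> simp [fracKernel, Side.opp]

theorem fracKernelDeriv_opp (s : Side) (α t : ℝ) :
    fracKernelDeriv s.opp α t = fracKernelDeriv s α (-t) := by
  cases s <;> simp [fracKernelDeriv, Side.opp]

/-- The reflection `t ↦ -t` exchanges the two kernels, so each kernel estimate is computed for the
left side only and transported by symmetry. -/
theorem forall_side_of_left {P : Side → Prop} (h : P .left) (hopp : ∀ s, P s → P s.opp)
    (s : Side) : P s := by
  cases s
  · exact h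
  · exact hopp _ h

theorem locallyIntegrable_fracKernel (s : Side) {α : ℝ} (hα1 : α < 1) :
    LocallyIntegrable (fracKernel s α) volume := by
  refine forall_side_of_left (P := fun s => LocallyIntegrable (fracKernel s α) volume) ?_ ?_ s
  · rw [locallyIntegrable_iff]
    intro K hK
    obtain ⟨R, hR⟩ := hK.isBounded.subset_closedBall 0
    rw [Real.closedBall_eq_Icc, zero_sub, zero_add] at hR
    by_cases hR0 : 0 ≤ R
    · refine IntegrableOn.mono_set ?_ hR
      have h := (intervalIntegral.intervalIntegrable_rpow' (a := -R) (b := R)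
        (r := -α) (by linarith)).1
      rw [← integrableOn_Icc_iff_integrableOn_Ioc] at h
      exact (Integrable.const_mul h _).indicator measurableSet_Ioi
    · rw [Icc_eq_empty (by linarith), subset_empty_iff] at hR
      simp [hR]
  · intro s hs
    have he : fracKernel s.opp α = fun t => -fracKernel s α (-t) := funext (fracKernel_opp s α)
    rw [he, locallyIntegrable_iff]
    intro K hK
    have h1 : IntegrableOn (fracKernel s α) (Neg.neg ⁻¹' K) volume :=
      hs.integrableOn_isCompact ((Homeomorph.neg ℝ).isCompact_preimage.2 hK)
    have h2 := ((Measure.measurePreserving_neg (volume : Measure ℝ)).integrableOn_comp_preimage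
      (Homeomorph.neg ℝ).measurableEmbedding (f := fracKernel s α) (s := Neg.neg ⁻¹' K)).2 h1
    rw [← preimage_comp] at h2
    simpa [Function.comp_def] using h2.neg

theorem hasDerivAt_fracKernel (s : Side) {α t : ℝ} (ht : t ≠ 0) :
    HasDerivAt (fracKernel s α) (fracKernelDeriv s α t) t := by
  revert t
  refine forall_side_of_left (P := fun s => ∀ {t : ℝ}, t ≠ 0 →
    HasDerivAt (fracKernel s α) (fracKernelDeriv s α t) t) ?_ ?_ s
  · intro t ht
    rcases lt_or_gt_of_ne ht with h | h
    · have h1 : fracKernelDeriv .left α t = 0 := by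
        simp [fracKernelDeriv, h.le]
      rw [h1]
      refine (hasDerivAt_const t (0 : ℝ)).congr_of_eventuallyEq ?_
      filter_upwards [Iio_mem_nhds h] with r hr
      simp [fracKernel, (mem_Iio.1 hr).le]
    · have h1 : fracKernelDeriv .left α t = (Real.Gamma (1 - α))⁻¹ * (-α * t ^ (-α - 1)) := by
        simp [fracKernelDeriv, h]
      rw [h1]
      refine ((Real.hasDerivAt_rpow_const (Or.inl ht)).const_mul _).congr_of_eventuallyEq ?_
      filter_upwards [Ioi_mem_nhds h] with r hr
      simp [fracKernel, mem_Ioi.1 hr]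
  · intro s hs t ht
    rw [show fracKernel s.opp α = fun t => -fracKernel s α (-t) from funext (fracKernel_opp s α),
      fracKernelDeriv_opp]
    simpa [Function.comp_def] using
      ((hs (neg_ne_zero.2 ht)).comp t (hasDerivAt_neg t)).fun_neg

theorem abs_fracKernelDeriv_le (s : Side) {α : ℝ} (hα0 : 0 < α) (hα1 : α < 1) (t : ℝ) :
    |fracKernelDeriv s α t| ≤ (Real.Gamma (1 - α))⁻¹ * α * |t| ^ (-α - 1) := by
  revert t
  refine forall_side_of_left (P := fun s => ∀ t : ℝ,
    |fracKernelDeriv s α t| ≤ (Real.Gamma (1 - α))⁻¹ * α * |t| ^ (-α - 1)) ?_ ?_ s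
  · intro t
    have hc : 0 < (Real.Gamma (1 - α))⁻¹ := inv_pos.2 (Real.Gamma_pos_of_pos (by linarith))
    by_cases h : 0 < t
    · have h1 : fracKernelDeriv .left α t = (Real.Gamma (1 - α))⁻¹ * (-α * t ^ (-α - 1)) := by
        simp [fracKernelDeriv, h]
      have h2 : 0 < t ^ (-α - 1) := Real.rpow_pos_of_pos h _
      rw [h1, abs_mul, abs_mul, abs_neg, abs_of_pos hc, abs_of_pos hα0, abs_of_pos h2,
        abs_of_pos h, mul_assoc]
    · have h1 : fracKernelDeriv .left α t = 0 := by
        simp [fracKernelDeriv, not_lt.1 h]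
      rw [h1, abs_zero]
      positivity
  · intro s hs t
    rw [fracKernelDeriv_opp]
    simpa using hs (-t)

theorem continuousAt_fracKernelDeriv (s : Side) {α t : ℝ} (ht : t ≠ 0) :
    ContinuousAt (fracKernelDeriv s α) t := by
  revert t
  refine forall_side_of_left (P := fun s => ∀ {t : ℝ}, t ≠ 0 →
    ContinuousAt (fracKernelDeriv s α) t) ?_ ?_ s
  · intro t ht
    rcases lt_or_gt_of_ne ht with h | h
    · refine (continuousAt_const (y := (0 : ℝ))).congr ?_
      filter_upwards [Iio_mem_nhds h] with r hr
      simp [fracKernelDeriv, (mem_Iio.1 hr).le]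
    · refine (((Real.continuousAt_rpow_const t (-α - 1) (Or.inl ht)).const_mul (-α)).const_mul
        (Real.Gamma (1 - α))⁻¹).congr ?_
      filter_upwards [Ioi_mem_nhds h] with r hr
      simp [fracKernelDeriv, mem_Ioi.1 hr]
  · intro s hs t ht
    rw [show fracKernelDeriv s.opp α = fun t => fracKernelDeriv s α (-t) from
      funext (fracKernelDeriv_opp s α)]
    exact (hs (neg_ne_zero.2 ht)).comp (f := fun t : ℝ => -t) continuous_neg.continuousAt

end Kernel

/-! ### Fractional derivatives of test functions as convolutions -/

section FracDeriv

theorem IsTestFunction.contDiff_one {φ : ℝ → ℝ} (hφ : IsTestFunction φ) : ContDiff ℝ 1 φ :=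
  hφ.1.of_le (by exact_mod_cast le_top)

theorem IsTestFunction.deriv {φ : ℝ → ℝ} (hφ : IsTestFunction φ) :
    IsTestFunction (deriv φ) :=
  ⟨((contDiff_infty_iff_deriv (𝕜 := ℝ)).1 hφ.1).2, hφ.2.deriv⟩

theorem IsTestFunction.comp_sub_left {φ : ℝ → ℝ} (hφ : IsTestFunction φ) (c : ℝ) :
    IsTestFunction (fun y => φ (c - y)) :=
  ⟨hφ.1.comp (contDiff_const.sub contDiff_id),
    hφ.2.comp_homeomorph (Homeomorph.subLeft c)⟩

theorem fracIntegral_left_eq (α : ℝ) (φ : ℝ → ℝ) :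
    fracIntegral .left (1 - α) φ = φ ⋆ fracKernel .left α := by
  funext x
  rw [convolution_lsmul, fracIntegral, ← integral_const_mul, ← integral_indicator measurableSet_Iio]
  congr 1 with y
  by_cases h : y < x
  · simp only [mem_Iio, h, indicator_of_mem, fracKernel, mem_Ioi, sub_pos, smul_eq_mul]
    rw [sub_sub_cancel, Real.rpow_neg (by linarith)]
    ring
  · simp [fracKernel, h]

/-- The sign built into the right kernel cancels the one in the right derivative, so both sides obey
a single convolution formula. -/
theorem fracIntegral_right_eq (α : ℝ) (φ : ℝ → ℝ) :
    fracIntegral .right (1 - α) φ = -(φ ⋆ fracKernel .right α) := by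
  funext x
  rw [Pi.neg_apply, convolution_lsmul, fracIntegral, ← integral_const_mul,
    ← integral_indicator measurableSet_Ioi, ← integral_neg]
  congr 1 with y
  by_cases h : x < y
  · simp only [mem_Ioi, h, indicator_of_mem, fracKernel, neg_sub, sub_pos, smul_eq_mul]
    rw [sub_sub_cancel, Real.rpow_neg (by linarith)]
    ring
  · simp [fracKernel, h]

theorem fracDeriv_eq_convolution (s : Side) {α : ℝ} (hα1 : α < 1) {φ : ℝ → ℝ}
    (hφ : IsTestFunction φ) : fracDeriv s α φ = deriv φ ⋆ fracKernel s α := by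
  have h : ∀ x, HasDerivAt (φ ⋆ fracKernel s α) ((deriv φ ⋆ fracKernel s α) x) x :=
    hφ.2.hasDerivAt_convolution_left _ hφ.contDiff_one (locallyIntegrable_fracKernel s hα1)
  funext x
  cases s
  · rw [fracDeriv, fracIntegral_left_eq, (h x).deriv]
  · rw [fracDeriv, fracIntegral_right_eq, (h x).neg.deriv, neg_neg]

theorem continuous_fracDeriv (s : Side) {α : ℝ} (hα1 : α < 1) {φ : ℝ → ℝ}
    (hφ : IsTestFunction φ) : Continuous (fracDeriv s α φ) := by
  rw [fracDeriv_eq_convolution s hα1 hφ]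
  exact hφ.deriv.2.continuous_convolution_left _ hφ.deriv.1.continuous
    (locallyIntegrable_fracKernel s hα1)

/-- Reflection swaps the directions. This turns the opposite derivative in the weak definition into
a convolution with the derivative of the same side. -/
theorem fracDeriv_opp_comp_sub_left (s : Side) {α : ℝ} (hα1 : α < 1) {φ : ℝ → ℝ}
    (hφ : IsTestFunction φ) (c y : ℝ) :
    fracDeriv s.opp α (fun z => φ (c - z)) y = fracDeriv s α φ (c - y) := by
  rw [fracDeriv_eq_convolution _ hα1 hφ, fracDeriv_eq_convolution _ hα1 (hφ.comp_sub_left c),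
    convolution_lsmul, convolution_lsmul,
    ← integral_sub_left_eq_self (fun t => deriv φ t • fracKernel s α (c - y - t)) volume c]
  congr 1 with t
  rw [fracKernel_opp, deriv_comp_const_sub]
  simp only [smul_eq_mul]
  rw [show c - y - (c - t) = -(y - t) by ring]
  ring

theorem locallyIntegrable_norm {f : ℝ → ℝ} (hf : LocallyIntegrable f volume) :
    LocallyIntegrable (fun x => ‖f x‖) volume := fun x =>
  let ⟨s, hs, h⟩ := hf x
  ⟨s, hs, h.norm⟩

/-- The ordinary derivative falls on the smooth factor `φ`, and associativity of convolution does
the rest; `g` needs no regularity, which allows a truncated `L^p` function. -/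
theorem fracDeriv_convolution (s : Side) {α : ℝ} (hα1 : α < 1) {φ g : ℝ → ℝ}
    (hφ : IsTestFunction φ) (hg : LocallyIntegrable g volume) (hgc : HasCompactSupport g)
    (hφg : IsTestFunction (φ ⋆ g)) :
    fracDeriv s α (φ ⋆ g) = g ⋆ fracDeriv s α φ := by
  have hk := locallyIntegrable_fracKernel s hα1
  have h1 : deriv (φ ⋆ g) = g ⋆ deriv φ := by
    funext x
    rw [(hφ.2.hasDerivAt_convolution_left _ hφ.contDiff_one hg x).deriv, convolution_lsmul,
      convolution_lsmul_swap]
    simp [mul_comm]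
  rw [fracDeriv_eq_convolution s hα1 hφg, fracDeriv_eq_convolution s hα1 hφ, h1]
  funext x
  have hd := hφ.deriv
  refine convolution_assoc _ _ _ _ (fun a b c => by simp [mul_assoc]) hg.aestronglyMeasurable
    hd.1.continuous.aestronglyMeasurable hk.aestronglyMeasurable ?_ ?_ ?_
  · exact Eventually.of_forall (hd.2.convolutionExists_right _ hg hd.1.continuous)
  · exact Eventually.of_forall
      (hd.2.norm.convolutionExists_left _ hd.1.continuous.norm (locallyIntegrable_norm hk))
  · refine hgc.norm.convolutionExists_left_of_continuous_right _ (locallyIntegrable_norm hg) ?_ x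
    exact hd.2.norm.continuous_convolution_left _ hd.1.continuous.norm (locallyIntegrable_norm hk)

theorem isTestFunction_convolution {φ g : ℝ → ℝ} (hφ : IsTestFunction φ)
    (hg : LocallyIntegrable g volume) (hgc : HasCompactSupport g) : IsTestFunction (φ ⋆ g) :=
  ⟨hφ.2.contDiff_convolution_left (n := (⊤ : ℕ∞)) _ hφ.1 hg, hφ.2.convolution _ hgc⟩

theorem IsTestFunction.locallyIntegrable {φ : ℝ → ℝ} (hφ : IsTestFunction φ) :
    LocallyIntegrable φ volume := hφ.1.continuous.locallyIntegrable

theorem convolution_real_comm (f g : ℝ → ℝ) : f ⋆ g = g ⋆ f := by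
  funext x
  rw [convolution_lsmul, convolution_lsmul_swap]
  simp [mul_comm]

/-- Fractional integration by parts. -/
theorem isWeakFracDeriv_fracDeriv (s : Side) {α : ℝ} (hα1 : α < 1) {f : ℝ → ℝ}
    (hf : IsTestFunction f) : IsWeakFracDeriv s α f (fracDeriv s α f) := by
  refine ⟨(continuous_fracDeriv s hα1 hf).locallyIntegrable, fun φ hφ => ?_⟩
  have hr := hφ.comp_sub_left 0
  set r : ℝ → ℝ := fun y => φ (0 - y) with hrdef
  -- Both sides are `D^α (f ⋆ r)` at `0`, with the derivative moved onto either factor. Since `r` is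
  -- the reflection of `φ`, evaluation at `0` gives the two pairings.
  have h1 : (fracDeriv s α f ⋆ r) 0 = (f ⋆ fracDeriv s α r) 0 := by
    rw [← fracDeriv_convolution s hα1 hr hf.locallyIntegrable hf.2
      (isTestFunction_convolution hr hf.locallyIntegrable hf.2), convolution_real_comm r f,
      fracDeriv_convolution s hα1 hf hr.locallyIntegrable hr.2
      (isTestFunction_convolution hf hr.locallyIntegrable hr.2), convolution_real_comm]
  rw [convolution_lsmul, convolution_lsmul] at h1
  have h2 : ∀ y, fracDeriv s α r (0 - y) = fracDeriv s.opp α φ y := fun y => by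
    rw [← fracDeriv_opp_comp_sub_left s hα1 hr]
    simp [hrdef]
  simp only [h2] at h1
  simpa [hrdef] using h1

end FracDeriv

/-! ### Decay and integrability of fractional derivatives -/

section Decay

theorem integral_eq_intervalIntegral_of_eq_zero {f : ℝ → ℝ} {R : ℝ} (hR : 0 < R)
    (hf : ∀ y, R < |y| → f y = 0) : ∫ y, f y = ∫ y in (-R)..R, f y := by
  rw [intervalIntegral.integral_of_le (by linarith), ← integral_Icc_eq_integral_Ioc,
    setIntegral_eq_integral_of_forall_compl_eq_zero]
  intro y hy
  refine hf y ?_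
  rw [mem_Icc, ← abs_le] at hy
  exact not_le.1 hy

/-- Integration by parts moves the derivative to the kernel, which is smooth at distance at least
`|x|/2` from the origin. Only the `L^1` norm of `φ` and its support radius enter, so the estimate is
uniform over mollifiers. -/
theorem abs_fracDeriv_le (s : Side) {α : ℝ} (hα0 : 0 < α) (hα1 : α < 1) {φ : ℝ → ℝ}
    (hφ : IsTestFunction φ) {R : ℝ} (hR : 0 < R) (hsupp : ∀ y, R ≤ |y| → φ y = 0) {x : ℝ}
    (hx : 2 * R ≤ |x|) :
    |fracDeriv s α φ x| ≤
      (Real.Gamma (1 - α))⁻¹ * α * (|x| / 2) ^ (-α - 1) * ∫ y, |φ y| := by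
  have hc : 0 < (Real.Gamma (1 - α))⁻¹ := inv_pos.2 (Real.Gamma_pos_of_pos (by linarith))
  have hd : ∀ y, R < |y| → deriv φ y = 0 := by
    intro y hy
    have : φ =ᶠ[𝓝 y] fun _ => 0 := by
      filter_upwards [continuous_abs.continuousAt.eventually (lt_mem_nhds hy)] with z hz
      exact hsupp z hz.le
    rw [this.deriv_eq, deriv_const]
  have hfar : ∀ y ∈ uIcc (-R) R, |x| / 2 ≤ |x - y| := by
    intro y hy
    rw [uIcc_of_le (by linarith), mem_Icc, ← abs_le] at hy
    have := abs_sub_abs_le_abs_sub x y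
    linarith
  have hne : ∀ y ∈ uIcc (-R) R, x - y ≠ 0 := by
    intro y hy h
    have := hfar y hy
    rw [h, abs_zero] at this
    linarith
  have hkd : ∀ y ∈ uIcc (-R) R,
      HasDerivAt (fun y => fracKernel s α (x - y)) (-fracKernelDeriv s α (x - y)) y := by
    intro y hy
    simpa [Function.comp_def] using
      (hasDerivAt_fracKernel s (α := α) (hne y hy)).comp y ((hasDerivAt_id y).const_sub x)
  have hcont : ContinuousOn (fun y => -fracKernelDeriv s α (x - y)) (uIcc (-R) R) := by
    intro y hy
    exact ((continuousAt_fracKernelDeriv s (hne y hy)).comp (f := fun y : ℝ => x - y)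
      (continuous_const.sub continuous_id).continuousAt).neg.continuousWithinAt
  have hparts := intervalIntegral.integral_mul_deriv_eq_deriv_mul (a := -R) (b := R) hkd
    (fun y _ => (hφ.contDiff_one.differentiable one_ne_zero y).hasDerivAt)
    hcont.intervalIntegrable (hφ.deriv.1.continuous.intervalIntegrable _ _)
  -- The boundary terms drop out because `φ` vanishes at `±R` themselves.
  rw [hsupp R (le_abs_self R), hsupp (-R) (by rw [abs_neg]; exact le_abs_self R), mul_zero,
    mul_zero, sub_zero, zero_sub] at hparts
  have h1 : fracDeriv s α φ x = ∫ y in (-R)..R, fracKernel s α (x - y) * deriv φ y := by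
    rw [fracDeriv_eq_convolution s hα1 hφ, convolution_lsmul,
      integral_eq_intervalIntegral_of_eq_zero hR]
    · simp only [smul_eq_mul, mul_comm]
    · intro y hy
      rw [hd y hy, zero_smul]
  rw [h1, hparts, abs_neg]
  have h2 : ∫ y, |φ y| = ∫ y in (-R)..R, |φ y| :=
    integral_eq_intervalIntegral_of_eq_zero hR fun y hy => by rw [hsupp y hy.le, abs_zero]
  rw [h2, ← intervalIntegral.integral_const_mul]
  refine (Real.norm_eq_abs _).ge.trans ?_
  refine intervalIntegral.norm_integral_le_of_norm_le (by linarith) (Eventually.of_forall ?_)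
    ((continuous_const.mul hφ.1.continuous.abs).intervalIntegrable _ _)
  intro y hy
  have hy' : y ∈ uIcc (-R) R := by
    rw [uIcc_of_le (by linarith)]; exact Ioc_subset_Icc_self hy
  rw [norm_mul, Real.norm_eq_abs, Real.norm_eq_abs, abs_neg]
  refine mul_le_mul_of_nonneg_right ((abs_fracKernelDeriv_le s hα0 hα1 _).trans ?_)
    (abs_nonneg _)
  refine mul_le_mul_of_nonneg_left ?_ (by positivity)
  exact Real.rpow_le_rpow_of_nonpos (by linarith) (hfar y hy') (by linarith)

theorem japaneseWeight_memLp {α : ℝ} (hα0 : 0 < α) {r : ℝ≥0∞} (hr : 1 ≤ r) :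
    MemLp (fun x : ℝ => (1 + |x|) ^ (-(1 + α))) r volume := by
  have hcont : Continuous (fun x : ℝ => (1 + |x|) ^ (-(1 + α))) := by
    exact (continuous_const.add continuous_abs).rpow_const fun x => Or.inl
      (by linarith [abs_nonneg x] : (0 : ℝ) < 1 + |x|).ne'
  have h0 : ∀ x : ℝ, 0 ≤ (1 + |x|) ^ (-(1 + α)) := fun x => by positivity
  by_cases ht : r = ⊤
  · rw [ht]
    refine memLp_top_of_bound hcont.aestronglyMeasurable 1 (Eventually.of_forall fun x => ?_)
    rw [Real.norm_of_nonneg (h0 x)]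
    exact Real.rpow_le_one_of_one_le_of_nonpos (by linarith [abs_nonneg x]) (by linarith)
  · have hr0 : r ≠ 0 := (zero_lt_one.trans_le hr).ne'
    rw [← integrable_norm_rpow_iff hcont.aestronglyMeasurable hr0 ht]
    have h1 : 1 ≤ r.toReal := by
      rw [← ENNReal.toReal_one]; exact ENNReal.toReal_mono ht hr
    have h2 := integrable_one_add_norm (E := ℝ) (μ := volume) (r := (1 + α) * r.toReal)
      (by rw [Module.finrank_self]; push_cast; nlinarith)
    refine h2.congr (Eventually.of_forall fun x => ?_)
    simp only
    rw [Real.norm_of_nonneg (h0 x), ← Real.rpow_mul (by positivity), Real.norm_eq_abs, neg_mul]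

theorem rpow_half_abs_le {α x : ℝ} (hα0 : 0 < α) (hx : 1 ≤ |x|) :
    (|x| / 2) ^ (-α - 1) ≤ 4 ^ (1 + α) * (1 + |x|) ^ (-(1 + α)) := by
  have h1 : (|x| / 2) ^ (-α - 1) ≤ ((1 + |x|) / 4) ^ (-α - 1) :=
    Real.rpow_le_rpow_of_nonpos (by positivity) (by linarith) (by linarith)
  refine h1.trans_eq ?_
  rw [Real.div_rpow (by positivity) (by norm_num), show -α - 1 = -(1 + α) by ring,
    Real.rpow_neg (by norm_num : (0 : ℝ) ≤ 4), div_inv_eq_mul, mul_comm]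

theorem exists_abs_fracDeriv_le (s : Side) {α : ℝ} (hα0 : 0 < α) (hα1 : α < 1) {φ : ℝ → ℝ}
    (hφ : IsTestFunction φ) :
    ∃ C, ∀ x, |fracDeriv s α φ x| ≤ C * (1 + |x|) ^ (-(1 + α)) := by
  obtain ⟨R, hR1, hR⟩ : ∃ R : ℝ, 1 ≤ R ∧ ∀ y, R ≤ |y| → φ y = 0 := by
    obtain ⟨R, hR⟩ := hφ.2.isCompact.isBounded.subset_closedBall 0
    -- The extra unit makes `φ` vanish on `|y| = R` too; `1 ≤ R` allows `rpow_half_abs_le` on `|x| ≥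
    -- 2R`.
    refine ⟨max 1 (R + 1), le_max_left _ _, fun y hy => image_eq_zero_of_notMem_tsupport ?_⟩
    intro h
    have := hR h
    rw [mem_closedBall_zero_iff, Real.norm_eq_abs] at this
    linarith [le_max_right 1 (R + 1)]
  obtain ⟨M, hM⟩ := (isCompact_Icc (a := -(2 * R)) (b := 2 * R)).exists_bound_of_continuousOn
    (continuous_fracDeriv s hα1 hφ).continuousOn
  have hc : 0 < (Real.Gamma (1 - α))⁻¹ := inv_pos.2 (Real.Gamma_pos_of_pos (by linarith))
  have hI : 0 ≤ ∫ y, |φ y| := integral_nonneg fun y => abs_nonneg _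
  set A := (Real.Gamma (1 - α))⁻¹ * α * 4 ^ (1 + α) * ∫ y, |φ y| with hA
  have hA0 : 0 ≤ A := by positivity
  have hM0 : 0 ≤ M := (norm_nonneg _).trans (hM 0 (by constructor <;> linarith))
  -- `A` serves the far region; the second term serves `|x| ≤ 2R`, where the weight is at least `(1
  -- + 2R)^(-(1+α))`.
  refine ⟨A + M * (1 + 2 * R) ^ (1 + α), fun x => ?_⟩
  have hw : 0 < (1 + |x|) ^ (-(1 + α)) := Real.rpow_pos_of_pos (by positivity) _
  rw [add_mul]
  rcases le_total (2 * R) |x| with h | h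
  · have h1 := abs_fracDeriv_le s hα0 hα1 hφ (by linarith) hR h
    have h2 := rpow_half_abs_le hα0 (x := x) (by linarith)
    have h3 : (Real.Gamma (1 - α))⁻¹ * α * (|x| / 2) ^ (-α - 1) * ∫ y, |φ y| ≤
        (Real.Gamma (1 - α))⁻¹ * α * (4 ^ (1 + α) * (1 + |x|) ^ (-(1 + α))) * ∫ y, |φ y| := by
      gcongr
    have h4 : 0 ≤ M * (1 + 2 * R) ^ (1 + α) * (1 + |x|) ^ (-(1 + α)) := by positivity
    rw [hA]
    linarith
  · have h1 := hM x (abs_le.1 h)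
    rw [Real.norm_eq_abs] at h1
    have h2 : 1 ≤ (1 + 2 * R) ^ (1 + α) * (1 + |x|) ^ (-(1 + α)) := by
      rw [Real.rpow_neg (by positivity), ← div_eq_mul_inv, one_le_div (by positivity)]
      gcongr
    have h3 : 0 ≤ A * (1 + |x|) ^ (-(1 + α)) := by positivity
    nlinarith

theorem memLp_fracDeriv (s : Side) {α : ℝ} (hα0 : 0 < α) (hα1 : α < 1) {φ : ℝ → ℝ}
    (hφ : IsTestFunction φ) {r : ℝ≥0∞} (hr : 1 ≤ r) : MemLp (fracDeriv s α φ) r volume := by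
  obtain ⟨C, hC⟩ := exists_abs_fracDeriv_le s hα0 hα1 hφ
  exact ((japaneseWeight_memLp hα0 hr).const_mul C).mono'
    (continuous_fracDeriv s hα1 hφ).aestronglyMeasurable (Eventually.of_forall hC)

theorem one_le_conjExponent (p : ℝ≥0∞) : 1 ≤ p.conjExponent := by
  simp [ENNReal.conjExponent]

theorem integrable_mul_of_memLp_conjExponent {p : ℝ≥0∞} (hp1 : 1 ≤ p) {f g : ℝ → ℝ}
    (hf : MemLp f p volume) (hg : MemLp g p.conjExponent volume) :
    Integrable (fun x => f x * g x) volume :=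
  have := ENNReal.HolderConjugate.conjExponent hp1
  MemLp.integrable_mul hf hg

end Decay

/-! ### Closedness of the weak derivative under limits -/

section Stability

theorem abs_integral_mul_sub_le {μ : Measure ℝ} {p p' : ℝ≥0∞} [p.HolderConjugate p']
    {f f' g : ℝ → ℝ} (hf : MemLp f p μ) (hf' : MemLp f' p μ) (hg : MemLp g p' μ) :
    ENNReal.ofReal |(∫ x, f x * g x ∂μ) - ∫ x, f' x * g x ∂μ| ≤
      eLpNorm (f - f') p μ * eLpNorm g p' μ := by
  have h1 : Integrable (fun x => f x * g x) μ := MemLp.integrable_mul hf hg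
  have h2 : Integrable (fun x => f' x * g x) μ := MemLp.integrable_mul hf' hg
  rw [← integral_sub h1 h2, ← Real.enorm_eq_ofReal_abs]
  refine (enorm_integral_le_lintegral_enorm _).trans ?_
  rw [← eLpNorm_one_eq_lintegral_enorm]
  rw [show (fun x => f x * g x - f' x * g x) = (f - f') • g by funext x; simp [sub_mul]]
  exact eLpNorm_smul_le_mul_eLpNorm hg.1 (hf.sub hf').1

theorem tendsto_integral_mul_of_tendsto_eLpNorm {μ : Measure ℝ} {p : ℝ≥0∞} (hp1 : 1 ≤ p)
    {F : ℕ → ℝ → ℝ} {f g : ℝ → ℝ} (hF : ∀ j, MemLp (F j) p μ) (hf : MemLp f p μ)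
    (hg : MemLp g p.conjExponent μ)
    (h : Tendsto (fun j => eLpNorm (F j - f) p μ) atTop (𝓝 0)) :
    Tendsto (fun j => ∫ x, F j x * g x ∂μ) atTop (𝓝 (∫ x, f x * g x ∂μ)) := by
  have := ENNReal.HolderConjugate.conjExponent hp1
  rw [tendsto_iff_edist_tendsto_0]
  have h1 : Tendsto (fun j => eLpNorm (F j - f) p μ * eLpNorm g p.conjExponent μ) atTop (𝓝 0) := by
    simpa using ENNReal.Tendsto.mul_const h (Or.inr hg.2.ne)
  refine tendsto_of_tendsto_of_tendsto_of_le_of_le tendsto_const_nhds h1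
    (fun j => zero_le) fun j => ?_
  rw [edist_dist, Real.dist_eq]
  exact abs_integral_mul_sub_le (hF j) hf hg

theorem IsTestFunction.memLp {φ : ℝ → ℝ} (hφ : IsTestFunction φ) (r : ℝ≥0∞) (μ : Measure ℝ)
    [IsFiniteMeasureOnCompacts μ] : MemLp φ r μ :=
  hφ.1.continuous.memLp_of_hasCompactSupport hφ.2

theorem integral_mul_eq_restrict_tsupport (f φ : ℝ → ℝ) :
    ∫ x, f x * φ x = ∫ x in tsupport φ, f x * φ x := by
  rw [setIntegral_eq_integral_of_forall_compl_eq_zero]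
  intro x hx
  rw [image_eq_zero_of_notMem_tsupport hx, mul_zero]

theorem MemLpLoc.locallyIntegrable {v : ℝ → ℝ} {q : ℝ≥0∞} (hq1 : 1 ≤ q) (hv : MemLpLoc v q) :
    LocallyIntegrable v volume := by
  rw [locallyIntegrable_iff]
  intro K hK
  have : IsFiniteMeasure (volume.restrict K) := ⟨by simpa using hK.measure_lt_top⟩
  exact (hv K hK).integrable hq1

/-- Hölder on the whole line handles the pairing with `u`, since the test derivative lies in the
conjugate space; on the compact support of `φ` it handles the pairing with `v`. -/
theorem isWeakFracDeriv_of_tendsto (s : Side) {α : ℝ} (hα0 : 0 < α) (hα1 : α < 1) {p q : ℝ≥0∞}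
    (hp1 : 1 ≤ p) (hq1 : 1 ≤ q) {u v : ℝ → ℝ} (hu : MemLp u p volume) {U V : ℕ → ℝ → ℝ}
    (hU : ∀ j, MemLp (U j) p volume) (hUV : ∀ j, IsWeakFracDeriv s α (U j) (V j))
    (hUu : Tendsto (fun j => eLpNorm (U j - u) p volume) atTop (𝓝 0))
    (hVv : TendstoLpLoc V v q) : IsWeakFracDeriv s α u v := by
  refine ⟨hVv.2.1.locallyIntegrable hq1, fun φ hφ => ?_⟩
  have h1 := tendsto_integral_mul_of_tendsto_eLpNorm hp1 hU hu
    (memLp_fracDeriv s.opp hα0 hα1 hφ (one_le_conjExponent p)) hUu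
  have hK := hφ.2.isCompact
  have h2 := tendsto_integral_mul_of_tendsto_eLpNorm hq1 (fun j => hVv.1 j _ hK) (hVv.2.1 _ hK)
    (hφ.memLp _ (volume.restrict (tsupport φ))) (hVv.2.2 _ hK)
  rw [integral_mul_eq_restrict_tsupport]
  refine tendsto_nhds_unique (h2.congr fun j => ?_) h1
  rw [← integral_mul_eq_restrict_tsupport, (hUV j).2 φ hφ]

end Stability

/-! ### The standard mollifier -/

section Mollifier

theorem isTestFunction_of_eq_zero {φ : ℝ → ℝ} (hφ : ContDiff ℝ ∞ φ) {R : ℝ}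
    (hR : ∀ x, R ≤ |x| → φ x = 0) : IsTestFunction φ := by
  refine ⟨hφ, HasCompactSupport.intro (isCompact_closedBall (0 : ℝ) R) fun x hx => hR x ?_⟩
  rw [mem_closedBall_zero_iff, Real.norm_eq_abs, not_le] at hx
  exact hx.le

theorem expNegInvGlue_one_sub_sq_eq_zero {x : ℝ} (hx : 1 ≤ |x|) :
    expNegInvGlue (1 - x ^ 2) = 0 := by
  refine expNegInvGlue.zero_of_nonpos ?_
  have := one_le_sq_iff_one_le_abs x |>.2 hx
  linarith

theorem isTestFunction_expNegInvGlue_one_sub_sq :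
    IsTestFunction (fun x : ℝ => expNegInvGlue (1 - x ^ 2)) :=
  isTestFunction_of_eq_zero
    (expNegInvGlue.contDiff.comp (contDiff_const.sub (contDiff_id.pow 2)))
    fun _ => expNegInvGlue_one_sub_sq_eq_zero

theorem integral_expNegInvGlue_one_sub_sq_pos :
    0 < ∫ y : ℝ, expNegInvGlue (1 - y ^ 2) := by
  refine isTestFunction_expNegInvGlue_one_sub_sq.1.continuous
    |>.integral_pos_of_hasCompactSupport_nonneg_nonzero (x := 0)
    isTestFunction_expNegInvGlue_one_sub_sq.2 (fun x => expNegInvGlue.nonneg _) ?_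
  exact (expNegInvGlue.pos_of_pos (by norm_num)).ne'

theorem mollifier_eq_zero {ε : ℝ} (hε : 0 < ε) {x : ℝ} (hx : ε ≤ |x|) : mollifier ε x = 0 := by
  rw [mollifier, stdMollifier, expNegInvGlue_one_sub_sq_eq_zero, zero_div, mul_zero]
  rwa [abs_div, abs_of_pos hε, one_le_div hε]

theorem isTestFunction_mollifier {ε : ℝ} (hε : 0 < ε) : IsTestFunction (mollifier ε) := by
  refine isTestFunction_of_eq_zero ?_ fun x => mollifier_eq_zero hε
  exact contDiff_const.mul ((isTestFunction_expNegInvGlue_one_sub_sq.1.div_const _).comp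
    (contDiff_id.div_const ε))

theorem mollifier_nonneg {ε : ℝ} (hε : 0 < ε) (x : ℝ) : 0 ≤ mollifier ε x :=
  mul_nonneg (inv_nonneg.2 hε.le)
    (div_nonneg (expNegInvGlue.nonneg _) integral_expNegInvGlue_one_sub_sq_pos.le)

theorem integral_mollifier {ε : ℝ} (hε : 0 < ε) : ∫ x, mollifier ε x = 1 := by
  simp only [mollifier]
  rw [integral_const_mul, Measure.integral_comp_div, abs_of_pos hε, smul_eq_mul,
    inv_mul_cancel_left₀ hε.ne']
  simp only [stdMollifier]
  rw [integral_div, div_self integral_expNegInvGlue_one_sub_sq_pos.ne']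

end Mollifier

/-! ### Contraction of `L^q` under mollification -/

section Young

/-- Convolution with a probability density is a contraction of `L^q`. -/
theorem eLpNorm_convolution_le {η g : ℝ → ℝ} (hη : Continuous η) (hη0 : ∀ x, 0 ≤ η x)
    (hη1 : ∫ x, η x = 1) {q : ℝ≥0∞} (hq1 : 1 ≤ q) (hq : q ≠ ⊤)
    (hg : AEStronglyMeasurable g volume) :
    eLpNorm (η ⋆ g) q volume ≤ eLpNorm g q volume := by
  -- A measurable representative of `g` gives the joint measurability that Tonelli requires.
  rw [convolution_congr _ (ae_eq_refl η) hg.ae_eq_mk, eLpNorm_congr_ae hg.ae_eq_mk]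
  obtain ⟨h, hh⟩ : ∃ h : ℝ → ℝ, h = hg.mk g := ⟨_, rfl⟩
  have hm : Measurable h := by rw [hh]; exact hg.stronglyMeasurable_mk.measurable
  rw [← hh]
  clear hh hg
  have hq0 : q ≠ 0 := (zero_lt_one.trans_le hq1).ne'
  have hr1 : 1 ≤ q.toReal := by
    rw [← ENNReal.toReal_one]; exact ENNReal.toReal_mono hq hq1
  have hr0 : 0 < q.toReal := by linarith
  have hmη : Measurable fun t => ENNReal.ofReal (η t) := hη.measurable.ennreal_ofReal
  have hint : Integrable η volume := by
    by_contra hcon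
    rw [integral_undef hcon] at hη1
    exact zero_ne_one hη1
  -- With `η dx` as a probability measure, monotonicity of power means gives the pointwise Jensen
  -- inequality; Tonelli and translation invariance then conclude.
  set μ : Measure ℝ := volume.withDensity fun t => ENNReal.ofReal (η t) with hμ
  have hprob : IsProbabilityMeasure μ := ⟨by
    rw [hμ, withDensity_apply _ MeasurableSet.univ, Measure.restrict_univ,
      ← ofReal_integral_eq_lintegral_ofReal hint (Eventually.of_forall hη0), hη1,
      ENNReal.ofReal_one]⟩
  have hpt : ∀ x, ‖(η ⋆ h) x‖ₑ ^ q.toReal ≤ ∫⁻ t, ‖h (x - t)‖ₑ ^ q.toReal ∂μ := by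
    intro x
    have h1 : ‖(η ⋆ h) x‖ₑ ≤ ∫⁻ t, ‖h (x - t)‖ₑ ∂μ := by
      rw [convolution_lsmul, hμ, lintegral_withDensity_eq_lintegral_mul _ hmη (by fun_prop)]
      refine (enorm_integral_le_lintegral_enorm _).trans_eq (lintegral_congr fun t => ?_)
      rw [enorm_smul, Real.enorm_of_nonneg (hη0 t)]
      rfl
    have h2 : eLpNorm' (fun t => h (x - t)) 1 μ ≤ eLpNorm' (fun t => h (x - t)) q.toReal μ :=
      eLpNorm'_le_eLpNorm'_of_exponent_le one_pos hr1 μ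
        (by fun_prop : Measurable _).aestronglyMeasurable
    simp only [eLpNorm', ENNReal.rpow_one, div_one] at h2
    calc ‖(η ⋆ h) x‖ₑ ^ q.toReal
        ≤ ((∫⁻ t, ‖h (x - t)‖ₑ ^ q.toReal ∂μ) ^ (1 / q.toReal)) ^ q.toReal :=
          ENNReal.rpow_le_rpow (h1.trans h2) hr0.le
      _ = _ := by
          rw [← ENNReal.rpow_mul, one_div_mul_cancel hr0.ne', ENNReal.rpow_one]
  rw [eLpNorm_eq_lintegral_rpow_enorm_toReal hq0 hq, eLpNorm_eq_lintegral_rpow_enorm_toReal hq0 hq]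
  refine ENNReal.rpow_le_rpow ?_ (by positivity)
  calc ∫⁻ x, ‖(η ⋆ h) x‖ₑ ^ q.toReal
      ≤ ∫⁻ x, ∫⁻ t, ‖h (x - t)‖ₑ ^ q.toReal ∂μ := lintegral_mono hpt
    _ = ∫⁻ t, ∫⁻ x, ‖h (x - t)‖ₑ ^ q.toReal ∂volume ∂μ := by
        refine lintegral_lintegral_swap (Measurable.aemeasurable ?_)
        exact ((hm.comp (measurable_fst.sub measurable_snd)).enorm).pow_const _
    _ = ∫⁻ t, ∫⁻ x, ‖h x‖ₑ ^ q.toReal ∂volume ∂μ := by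
        refine lintegral_congr fun t => ?_
        exact lintegral_sub_right_eq_self (fun x => ‖h x‖ₑ ^ q.toReal) t
    _ = ∫⁻ x, ‖h x‖ₑ ^ q.toReal := by
        rw [lintegral_const, measure_univ, mul_one]

end Young

/-! ### Convergence of mollifications in `L^q` and `L^q_loc` -/

section Approximation

/-- Uniform continuity makes the error at most `δ`, and it lives on one fixed ball because the radii
are at most `1`. -/
theorem tendsto_eLpNorm_mollifier_convolution_of_continuous {g : ℝ → ℝ} (hg : Continuous g)
    (hgc : HasCompactSupport g) {q : ℝ≥0∞} (hq1 : 1 ≤ q) (hq : q ≠ ⊤) :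
    Tendsto (fun j : ℕ => eLpNorm (mollifier (1 / ((j + 1 : ℕ) : ℝ)) ⋆ g - g) q volume)
      atTop (𝓝 0) := by
  obtain ⟨R, hR⟩ := hgc.isCompact.isBounded.subset_closedBall 0
  have hzero : ∀ x, R < |x| → g x = 0 := fun x hx => image_eq_zero_of_notMem_tsupport fun h => by
    have := hR h
    rw [mem_closedBall_zero_iff, Real.norm_eq_abs] at this
    linarith
  set K : Set ℝ := Metric.closedBall 0 (R + 1) with hK
  have hKm : volume K ≠ ⊤ := (isCompact_closedBall _ _).measure_ne_top
  have hq0 : q ≠ 0 := (zero_lt_one.trans_le hq1).ne'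
  rw [ENNReal.tendsto_atTop_zero]
  intro ε hε
  set m := volume K ^ (1 / q.toReal) with hm
  have hm_top : m ≠ ⊤ := ENNReal.rpow_ne_top_of_nonneg (by positivity) hKm
  obtain ⟨δ, hδ0, hδ⟩ : ∃ δ : ℝ, 0 < δ ∧ ENNReal.ofReal δ * m ≤ ε := by
    by_cases hεt : ε = ⊤
    · exact ⟨1, one_pos, by rw [hεt]; exact le_top⟩
    · refine ⟨(ε / (m + 1)).toReal, ENNReal.toReal_pos ?_ ?_, ?_⟩
      · exact (ENNReal.div_pos hε.ne' (by simp [hm_top])).ne'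
      · exact ENNReal.div_ne_top hεt (by simp)
      · rw [ENNReal.ofReal_toReal (ENNReal.div_ne_top hεt (by simp))]
        refine (mul_le_mul_right (le_self_add : m ≤ m + 1) _).trans ?_
        rw [ENNReal.div_mul_cancel (by simp) (by simp [hm_top])]
  obtain ⟨ρ, hρ0, hρ⟩ := Metric.uniformContinuous_iff.1
    (hgc.uniformContinuous_of_continuous hg) δ hδ0
  obtain ⟨N, hN⟩ := exists_nat_one_div_lt hρ0
  refine ⟨N, fun j hj => ?_⟩
  have hj0 : (0 : ℝ) < 1 / ((j + 1 : ℕ) : ℝ) := by positivity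
  have hj1 : 1 / ((j + 1 : ℕ) : ℝ) ≤ 1 := by
    rw [div_le_one (by positivity)]; push_cast; linarith [(Nat.cast_nonneg j : (0 : ℝ) ≤ j)]
  have hjρ : 1 / ((j + 1 : ℕ) : ℝ) < ρ := by
    refine lt_of_le_of_lt ?_ hN
    push_cast
    gcongr
  set e := 1 / ((j + 1 : ℕ) : ℝ) with he
  have hsupp : Function.support (mollifier e) ⊆ Metric.ball 0 e := by
    intro x hx
    rw [mem_ball_zero_iff, Real.norm_eq_abs]
    by_contra hcon
    exact hx (mollifier_eq_zero hj0 (not_lt.1 hcon))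
  have hbound : ∀ x, ‖(mollifier e ⋆ g - g) x‖ ≤ K.indicator (fun _ => δ) x := by
    intro x
    by_cases hx : x ∈ K
    · rw [indicator_of_mem hx, Pi.sub_apply, ← dist_eq_norm]
      refine dist_convolution_le hδ0.le hsupp (mollifier_nonneg hj0) (integral_mollifier hj0)
        hg.aestronglyMeasurable fun y hy => (hρ ?_).le
      exact (Metric.mem_ball.1 hy).trans hjρ
    · rw [indicator_of_notMem hx, Pi.sub_apply]
      rw [hK, mem_closedBall_zero_iff, Real.norm_eq_abs, not_le] at hx
      have h0 : dist ((mollifier e ⋆ g) x) 0 ≤ 0 := by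
        refine dist_convolution_le le_rfl hsupp (mollifier_nonneg hj0) (integral_mollifier hj0)
          hg.aestronglyMeasurable fun y hy => ?_
        rw [hzero y, dist_self]
        have h1 : |y - x| < e := hy
        have h2 := abs_sub_abs_le_abs_sub x y
        rw [abs_sub_comm] at h2
        linarith
      rw [hzero x (by linarith), sub_zero, ← dist_zero_right]
      exact h0
  calc eLpNorm (mollifier e ⋆ g - g) q volume
      ≤ eLpNorm (K.indicator fun _ => δ) q volume := eLpNorm_mono_real hbound
    _ = ENNReal.ofReal δ * m := by
        rw [eLpNorm_indicator_const Metric.isClosed_closedBall.measurableSet hq0 hq,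
          Real.enorm_of_nonneg hδ0.le]
    _ ≤ ε := hδ

theorem continuous_mollifier_convolution {ε : ℝ} (hε : 0 < ε) {f : ℝ → ℝ}
    (hf : LocallyIntegrable f volume) : Continuous (mollifier ε ⋆ f) :=
  (isTestFunction_mollifier hε).2.continuous_convolution_left _
    (isTestFunction_mollifier hε).1.continuous hf

theorem mollifier_convolution_sub {ε : ℝ} (hε : 0 < ε) {f g : ℝ → ℝ}
    (hf : LocallyIntegrable f volume) (hg : LocallyIntegrable g volume) :
    mollifier ε ⋆ (f - g) = mollifier ε ⋆ f - mollifier ε ⋆ g := by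
  have hη := isTestFunction_mollifier hε
  funext x
  have h1 := hη.2.convolutionExists_left (ContinuousLinearMap.lsmul ℝ ℝ) hη.1.continuous hf x
  have h2 := hη.2.convolutionExists_left (ContinuousLinearMap.lsmul ℝ ℝ) hη.1.continuous hg x
  rw [Pi.sub_apply, convolution_def, convolution_def, convolution_def, ← integral_sub h1 h2]
  simp [mul_sub]

/-- The three-term density argument: the contraction property bounds the mollified error `f - g`. -/
theorem eLpNorm_mollifier_convolution_sub_le {ε : ℝ} (hε : 0 < ε) {f g : ℝ → ℝ}
    {q : ℝ≥0∞} (hq1 : 1 ≤ q) (hq : q ≠ ⊤)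
    (hf : MemLp f q volume) (hg : MemLp g q volume) :
    eLpNorm (mollifier ε ⋆ f - f) q volume ≤
      eLpNorm (f - g) q volume + eLpNorm (mollifier ε ⋆ g - g) q volume +
        eLpNorm (f - g) q volume := by
  have hη := isTestFunction_mollifier hε
  have hfl := hf.locallyIntegrable hq1
  have hgl := hg.locallyIntegrable hq1
  have hdecomp : mollifier ε ⋆ f - f =
      (mollifier ε ⋆ (f - g) + (mollifier ε ⋆ g - g)) + (g - f) := by
    rw [mollifier_convolution_sub hε hfl hgl]
    abel
  have hfg := hf.sub hg
  have hm1 : AEStronglyMeasurable (mollifier ε ⋆ (f - g)) volume :=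
    (continuous_mollifier_convolution hε (hfg.locallyIntegrable hq1)).aestronglyMeasurable
  have hm2 : AEStronglyMeasurable (mollifier ε ⋆ g - g) volume :=
    (continuous_mollifier_convolution hε hgl).aestronglyMeasurable.sub hg.1
  rw [hdecomp]
  refine (eLpNorm_add_le (hm1.add hm2) (hg.sub hf).1 hq1).trans ?_
  rw [eLpNorm_sub_comm g f]
  gcongr
  refine (eLpNorm_add_le hm1 hm2 hq1).trans ?_
  gcongr
  exact eLpNorm_convolution_le hη.1.continuous (mollifier_nonneg hε) (integral_mollifier hε)
    hq1 hq hfg.1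

theorem tendsto_eLpNorm_mollifier_convolution {f : ℝ → ℝ} {q : ℝ≥0∞} (hq1 : 1 ≤ q) (hq : q ≠ ⊤)
    (hf : MemLp f q volume) :
    Tendsto (fun j : ℕ => eLpNorm (mollifier (1 / ((j + 1 : ℕ) : ℝ)) ⋆ f - f) q volume)
      atTop (𝓝 0) := by
  rw [ENNReal.tendsto_atTop_zero]
  intro ε hε
  have hε3 : ε / 3 ≠ 0 := (ENNReal.div_pos hε.ne' (by simp)).ne'
  obtain ⟨g, hgc, hfg, hg, hgL⟩ := hf.exists_hasCompactSupport_eLpNorm_sub_le hq hε3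
  obtain ⟨N, hN⟩ := ENNReal.tendsto_atTop_zero.1
    (tendsto_eLpNorm_mollifier_convolution_of_continuous hg hgc hq1 hq) (ε / 3)
    (pos_iff_ne_zero.2 hε3)
  refine ⟨N, fun j hj => ?_⟩
  refine (eLpNorm_mollifier_convolution_sub_le (by positivity) hq1 hq hf hgL).trans ?_
  calc _ ≤ ε / 3 + ε / 3 + ε / 3 := by gcongr; exact hN j hj
    _ = ε := ENNReal.add_thirds ε

/-- Mollification converges in `L^q` on bounded sets for locally `L^q` functions. -/
theorem tendsto_eLpNorm_mollifier_convolution_restrict {f : ℝ → ℝ} {q : ℝ≥0∞} (hq1 : 1 ≤ q)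
    (hq : q ≠ ⊤) (hf : MemLpLoc f q) {K : Set ℝ} (hK : IsCompact K) :
    Tendsto (fun j : ℕ =>
      eLpNorm (mollifier (1 / ((j + 1 : ℕ) : ℝ)) ⋆ f - f) q (volume.restrict K))
      atTop (𝓝 0) := by
  obtain ⟨R, hR⟩ := hK.isBounded.subset_closedBall 0
  -- Radii are at most `1`, so on `K` the mollification sees `f` only on this ball, and `f` may be
  -- replaced by its restriction there.
  set B : Set ℝ := Metric.closedBall 0 (R + 1) with hB
  have hBm : MeasurableSet B := Metric.isClosed_closedBall.measurableSet
  have hF : MemLp (B.indicator f) q volume :=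
    (memLp_indicator_iff_restrict hBm).2 (hf B (isCompact_closedBall _ _))
  refine tendsto_of_tendsto_of_tendsto_of_le_of_le tendsto_const_nhds
    (tendsto_eLpNorm_mollifier_convolution hq1 hq hF) (fun j => zero_le) fun j => ?_
  have hj0 : (0 : ℝ) < 1 / ((j + 1 : ℕ) : ℝ) := by positivity
  have hj1 : 1 / ((j + 1 : ℕ) : ℝ) ≤ 1 := by
    rw [div_le_one (by positivity)]; push_cast; linarith [(Nat.cast_nonneg j : (0 : ℝ) ≤ j)]
  simp only
  set e := 1 / ((j + 1 : ℕ) : ℝ) with he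
  refine le_trans (le_of_eq ?_) (eLpNorm_restrict_le _ q volume K)
  refine eLpNorm_congr_ae ?_
  filter_upwards [ae_restrict_mem hK.measurableSet] with x hx
  have hxR := hR hx
  rw [mem_closedBall_zero_iff, Real.norm_eq_abs] at hxR
  have hmem : ∀ y, |y - x| ≤ e → y ∈ B := by
    intro y hy
    rw [hB, mem_closedBall_zero_iff, Real.norm_eq_abs]
    have := abs_sub_abs_le_abs_sub y x
    linarith
  have hxB : x ∈ B := hmem x (by simpa using hj0.le)
  rw [Pi.sub_apply, Pi.sub_apply, indicator_of_mem hxB, convolution_lsmul, convolution_lsmul]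
  congr 2 with t
  by_cases ht : e ≤ |t|
  · rw [mollifier_eq_zero hj0 ht, zero_smul, zero_smul]
  · rw [indicator_of_mem (hmem _ _)]
    rw [sub_sub_cancel_left, abs_neg]
    exact (not_le.1 ht).le

end Approximation

/-! ### Truncation by smooth cutoffs -/

section Cutoff

/-- The truncation `ψ_N u` of `u` by the cutoff `ψ_N(x) = ψ(|x| - N)`. -/
def truncation (ψ u : ℝ → ℝ) (N : ℕ) (x : ℝ) : ℝ :=
  ψ (|x| - (N : ℝ)) * u x

theorem exists_isCutoffProfile : ∃ ψ : ℝ → ℝ, IsCutoffProfile ψ :=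
  ⟨fun t => Real.smoothTransition (1 - t),
    Real.smoothTransition.contDiff.comp (contDiff_const.sub contDiff_id),
    fun t ht => Real.smoothTransition.one_of_one_le (by linarith),
    fun t ht => Real.smoothTransition.zero_of_nonpos (by linarith)⟩

theorem IsCutoffProfile.exists_bound {ψ : ℝ → ℝ} (hψ : IsCutoffProfile ψ) :
    ∃ M, 0 ≤ M ∧ ∀ t, |ψ t| ≤ M := by
  obtain ⟨M, hM⟩ := (isCompact_Icc (a := (0 : ℝ)) (b := 1)).exists_bound_of_continuousOn
    hψ.1.continuous.continuousOn
  have h1 : 1 ≤ M := by simpa [hψ.2.1 0 le_rfl] using hM 0 (by simp)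
  refine ⟨M, by linarith, fun t => ?_⟩
  rcases le_total t 0 with h | h
  · rw [hψ.2.1 t h, abs_one]; exact h1
  · rcases le_total t 1 with h' | h'
    · exact hM t ⟨h, h'⟩
    · rw [hψ.2.2 t h', abs_zero]; linarith

variable {ψ u : ℝ → ℝ} {p : ℝ≥0∞}

theorem truncation_memLp (hψ : IsCutoffProfile ψ) (hu : MemLp u p volume) (N : ℕ) :
    MemLp (truncation ψ u N) p volume := by
  obtain ⟨M, -, hM⟩ := hψ.exists_bound
  -- Continuity suffices here: smoothness of the approximants comes from the mollifier.
  have hc : Continuous fun x : ℝ => ψ (|x| - (N : ℝ)) :=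
    hψ.1.continuous.comp (continuous_abs.sub continuous_const)
  refine hu.of_le_mul (c := M) (hc.aestronglyMeasurable.mul hu.1) (Eventually.of_forall fun x => ?_)
  rw [truncation, norm_mul]
  exact mul_le_mul_of_nonneg_right (hM _) (norm_nonneg _)

theorem hasCompactSupport_truncation (hψ : IsCutoffProfile ψ) (N : ℕ) :
    HasCompactSupport (truncation ψ u N) := by
  refine HasCompactSupport.intro (isCompact_closedBall (0 : ℝ) (N + 1)) fun x hx => ?_
  rw [mem_closedBall_zero_iff, Real.norm_eq_abs, not_le] at hx
  rw [truncation, hψ.2.2 _ (by linarith), zero_mul]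

theorem truncation_eq_self (hψ : IsCutoffProfile ψ) {N : ℕ} {x : ℝ} (hx : |x| ≤ N) :
    truncation ψ u N x = u x := by
  rw [truncation, hψ.2.1 _ (by linarith), one_mul]

/-- Dominated convergence: the error is eventually zero at each point. The dominating function is
`(M + 1) |u|`, as `ψ` need not take values in `[0, 1]`. -/
theorem tendsto_eLpNorm_truncation_sub (hψ : IsCutoffProfile ψ) (hp1 : 1 ≤ p) (hp : p ≠ ⊤)
    (hu : MemLp u p volume) :
    Tendsto (fun j : ℕ => eLpNorm (truncation ψ u (j + 1) - u) p volume) atTop (𝓝 0) := by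
  obtain ⟨M, hM0, hM⟩ := hψ.exists_bound
  have hp0 : p ≠ 0 := (zero_lt_one.trans_le hp1).ne'
  have hr0 : 0 < p.toReal := ENNReal.toReal_pos hp0 hp
  have hb : MemLp (fun x => (M + 1) * u x) p volume := hu.const_mul (M + 1)
  have hlim : Tendsto (fun j : ℕ => ∫⁻ x, ‖(truncation ψ u (j + 1) - u) x‖ₑ ^ p.toReal) atTop
      (𝓝 (∫⁻ _ : ℝ, 0)) := by
    refine tendsto_lintegral_of_dominated_convergence'
      (fun x => ‖(M + 1) * u x‖ₑ ^ p.toReal) (fun j => ?_) (fun j => ?_) ?_ ?_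
    · exact (((truncation_memLp hψ hu (j + 1)).sub hu).1.enorm).pow_const _
    · refine Eventually.of_forall fun x => ENNReal.rpow_le_rpow ?_ hr0.le
      rw [enorm_le_iff_norm_le, norm_mul, Pi.sub_apply, truncation, ← sub_one_mul, norm_mul,
        Real.norm_of_nonneg (by linarith : 0 ≤ M + 1)]
      refine mul_le_mul_of_nonneg_right ((norm_sub_le _ _).trans ?_) (norm_nonneg _)
      rw [norm_one]
      exact add_le_add_left (hM _) 1
    · exact (lintegral_rpow_enorm_lt_top_of_eLpNorm_lt_top hp0 hp hb.2).ne
    · refine Eventually.of_forall fun x => tendsto_const_nhds.congr' ?_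
      filter_upwards [eventually_ge_atTop ⌈|x|⌉₊] with j hj
      rw [Pi.sub_apply, truncation_eq_self hψ, sub_self, enorm_zero, ENNReal.zero_rpow_of_pos hr0]
      exact (Nat.le_ceil _).trans (by exact_mod_cast hj.trans (Nat.le_succ j))
  simp only [lintegral_zero] at hlim
  have h := ((ENNReal.continuous_rpow_const (y := 1 / p.toReal)).tendsto 0).comp hlim
  rw [ENNReal.zero_rpow_of_pos (by positivity)] at h
  refine h.congr fun j => ?_
  rw [Function.comp_apply, eLpNorm_eq_lintegral_rpow_enorm_toReal hp0 hp]

end Cutoff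

/-! ### Convergence of the mollified cutoffs and their derivatives -/

section MollifiedCutoff

variable {ψ u v : ℝ → ℝ} {p q : ℝ≥0∞}

theorem mollifiedCutoff_eq (ψ u : ℝ → ℝ) (N : ℕ) :
    mollifiedCutoff ψ u N = mollifier (1 / (N : ℝ)) ⋆ truncation ψ u N := rfl

/-- The shift to `j + 1` starts the sequence at one and keeps the radius positive. -/
theorem isTestFunction_mollifiedCutoff (hψ : IsCutoffProfile ψ) (hp1 : 1 ≤ p)
    (hu : MemLp u p volume) (j : ℕ) : IsTestFunction (mollifiedCutoff ψ u (j + 1)) :=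
  isTestFunction_convolution (isTestFunction_mollifier (by positivity))
    ((truncation_memLp hψ hu (j + 1)).locallyIntegrable hp1) (hasCompactSupport_truncation hψ _)

theorem tendsto_eLpNorm_mollifiedCutoff_sub (hψ : IsCutoffProfile ψ) (hp1 : 1 ≤ p) (hp : p ≠ ⊤)
    (hu : MemLp u p volume) :
    Tendsto (fun j : ℕ => eLpNorm (mollifiedCutoff ψ u (j + 1) - u) p volume) atTop (𝓝 0) := by
  have h := (tendsto_eLpNorm_truncation_sub hψ hp1 hp hu).add
    (tendsto_eLpNorm_mollifier_convolution hp1 hp hu)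
  rw [add_zero] at h
  refine tendsto_of_tendsto_of_tendsto_of_le_of_le tendsto_const_nhds h (fun j => zero_le)
    fun j => ?_
  have hε : (0 : ℝ) < 1 / ((j + 1 : ℕ) : ℝ) := by positivity
  have hg := truncation_memLp hψ hu (j + 1)
  have hη := isTestFunction_mollifier hε
  have hgu := hg.sub hu
  simp only
  rw [mollifiedCutoff_eq]
  have hdecomp : mollifier (1 / ((j + 1 : ℕ) : ℝ)) ⋆ truncation ψ u (j + 1) - u =
      mollifier (1 / ((j + 1 : ℕ) : ℝ)) ⋆ (truncation ψ u (j + 1) - u) +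
        (mollifier (1 / ((j + 1 : ℕ) : ℝ)) ⋆ u - u) := by
    rw [mollifier_convolution_sub hε (hg.locallyIntegrable hp1) (hu.locallyIntegrable hp1)]
    abel
  rw [hdecomp]
  refine (eLpNorm_add_le
    (continuous_mollifier_convolution hε (hgu.locallyIntegrable hp1)).aestronglyMeasurable
    ((continuous_mollifier_convolution hε
      (hu.locallyIntegrable hp1)).aestronglyMeasurable.sub hu.1) hp1).trans ?_
  gcongr
  exact eLpNorm_convolution_le hη.1.continuous (mollifier_nonneg hε) (integral_mollifier hε)
    hp1 hp hgu.1

/-- The commutation `η ⋆ v = ∫ u(y) (D^α η)(x - y) dy` for a weak fractional derivative `v`. -/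
theorem IsWeakFracDeriv.mollifier_convolution {s : Side} {α : ℝ} (hα1 : α < 1)
    (huv : IsWeakFracDeriv s α u v) {η : ℝ → ℝ} (hη : IsTestFunction η) (x : ℝ) :
    (η ⋆ v) x = ∫ y, u y * fracDeriv s α η (x - y) := by
  -- The test function is `y ↦ η(x - y)`.
  have h := huv.2 _ (hη.comp_sub_left x)
  simp only [fracDeriv_opp_comp_sub_left s hα1 hη] at h
  rw [← h, convolution_lsmul_swap]
  simp only [smul_eq_mul, mul_comm]

/-- A Peetre-type inequality, from `1 + |y| ≤ (1 + R)(1 + |x - y|)`; it trades the weight at `x - y`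
for one independent of `x`. -/
theorem one_add_abs_rpow_neg_le {α R x y : ℝ} (hα0 : 0 < α) (hx : |x| ≤ R) :
    (1 + |x - y|) ^ (-(1 + α)) ≤ (1 + R) ^ (1 + α) * (1 + |y|) ^ (-(1 + α)) := by
  have hR : 0 ≤ R := (abs_nonneg x).trans hx
  have h1 : 1 + |y| ≤ (1 + R) * (1 + |x - y|) := by
    have := abs_sub_abs_le_abs_sub y x
    rw [abs_sub_comm] at this
    nlinarith [abs_nonneg (x - y)]
  have h2 : (1 + |y|) ^ (1 + α) ≤ (1 + R) ^ (1 + α) * (1 + |x - y|) ^ (1 + α) := by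
    rw [← Real.mul_rpow (by positivity) (by positivity)]
    gcongr
  rw [Real.rpow_neg (by positivity), Real.rpow_neg (by positivity), ← div_eq_mul_inv,
    inv_eq_one_div, div_le_div_iff₀ (by positivity) (by positivity), one_mul]
  exact h2

/-- Truncation commutes with the fractional derivative up to a uniformly small error on bounded
sets. -/
theorem abs_fracDeriv_mollifiedCutoff_sub_le {s : Side} {α : ℝ} (hα0 : 0 < α) (hα1 : α < 1)
    (hp1 : 1 ≤ p) (hu : MemLp u p volume) (huv : IsWeakFracDeriv s α u v)
    (hψ : IsCutoffProfile ψ) {R : ℝ} {j : ℕ} (hj : R + 2 ≤ j) {x : ℝ} (hx : |x| ≤ R) :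
    |fracDeriv s α (mollifiedCutoff ψ u (j + 1)) x -
        (mollifier (1 / ((j + 1 : ℕ) : ℝ)) ⋆ v) x| ≤
      (Real.Gamma (1 - α))⁻¹ * α * (4 ^ (1 + α) * (1 + R) ^ (1 + α)) *
        ∫ y, |truncation ψ u (j + 1) y - u y| * (1 + |y|) ^ (-(1 + α)) := by
  have hε : (0 : ℝ) < 1 / ((j + 1 : ℕ) : ℝ) := by positivity
  have hε1 : 1 / ((j + 1 : ℕ) : ℝ) ≤ 1 := by
    rw [div_le_one (by positivity)]; push_cast; linarith [(Nat.cast_nonneg j : (0 : ℝ) ≤ j)]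
  have hc : 0 < (Real.Gamma (1 - α))⁻¹ := inv_pos.2 (Real.Gamma_pos_of_pos (by linarith))
  have hη := isTestFunction_mollifier hε
  have hg := truncation_memLp hψ hu (j + 1)
  have hw : MemLp (fun y => fracDeriv s α (mollifier (1 / ((j + 1 : ℕ) : ℝ))) (x - y))
      p.conjExponent volume := by
    have := memLp_fracDeriv s.opp hα0 hα1 (hη.comp_sub_left x) (one_le_conjExponent p)
    rwa [funext (fracDeriv_opp_comp_sub_left s hα1 hη x)] at this
  rw [huv.mollifier_convolution hα1 hη, mollifiedCutoff_eq,
    fracDeriv_convolution s hα1 hη (hg.locallyIntegrable hp1) (hasCompactSupport_truncation hψ _)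
      (isTestFunction_mollifiedCutoff hψ hp1 hu j), convolution_lsmul]
  simp only [smul_eq_mul]
  rw [← integral_sub (integrable_mul_of_memLp_conjExponent hp1 hg hw)
    (integrable_mul_of_memLp_conjExponent hp1 hu hw), ← integral_const_mul]
  have hgu : MemLp (fun y => |truncation ψ u (j + 1) y - u y|) p volume := (hg.sub hu).norm
  refine (Real.norm_eq_abs _).ge.trans ?_
  refine norm_integral_le_of_norm_le ((integrable_mul_of_memLp_conjExponent hp1 hgu
    (japaneseWeight_memLp hα0 (one_le_conjExponent p))).const_mul _)
    (Eventually.of_forall fun y => ?_)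
  rw [← sub_mul, norm_mul, Real.norm_eq_abs, Real.norm_eq_abs]
  -- For `|y| ≤ j + 1` the truncation equals `u`, so the singular region of `D^α η` contributes
  -- nothing.
  rcases le_or_gt |y| ((j + 1 : ℕ) : ℝ) with hy | hy
  · simp [truncation_eq_self hψ hy]
  have hfar : 2 ≤ |x - y| := by
    have := abs_sub_abs_le_abs_sub y x
    rw [abs_sub_comm] at this
    push_cast at hy
    linarith
  have h1 := abs_fracDeriv_le s hα0 hα1 hη one_pos
    (fun z hz => mollifier_eq_zero hε (hε1.trans hz)) (x := x - y) (by linarith)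
  -- Unit mass removes the mollifier from the bound, leaving a constant independent of its radius.
  simp only [abs_of_nonneg (mollifier_nonneg hε _), integral_mollifier hε, mul_one] at h1
  have h2 := rpow_half_abs_le hα0 (x := x - y) (by linarith)
  have h3 := one_add_abs_rpow_neg_le (y := y) hα0 hx
  have h4 : |fracDeriv s α (mollifier (1 / ((j + 1 : ℕ) : ℝ))) (x - y)| ≤
      (Real.Gamma (1 - α))⁻¹ * α *
        (4 ^ (1 + α) * ((1 + R) ^ (1 + α) * (1 + |y|) ^ (-(1 + α)))) := by
    refine h1.trans ?_
    gcongr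
    refine h2.trans ?_
    gcongr
  refine (mul_le_mul_of_nonneg_left h4 (abs_nonneg _)).trans_eq ?_
  ring

theorem tendsto_integral_truncation_sub_mul_weight {α : ℝ} (hα0 : 0 < α) (hp1 : 1 ≤ p)
    (hp : p ≠ ⊤) (hu : MemLp u p volume) (hψ : IsCutoffProfile ψ) :
    Tendsto (fun j : ℕ => ∫ y, |truncation ψ u (j + 1) y - u y| * (1 + |y|) ^ (-(1 + α))) atTop
      (𝓝 0) := by
  have h := tendsto_integral_mul_of_tendsto_eLpNorm (μ := volume) hp1
    (F := fun j y => |truncation ψ u (j + 1) y - u y|) (f := 0)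
    (fun j => ((truncation_memLp hψ hu (j + 1)).sub hu).norm) MemLp.zero
    (japaneseWeight_memLp hα0 (one_le_conjExponent p)) ?_
  · simpa using h
  · refine (tendsto_eLpNorm_truncation_sub hψ hp1 hp hu).congr fun j => ?_
    rw [sub_zero, ← eLpNorm_norm]
    rfl

theorem memLpLoc_of_continuous {f : ℝ → ℝ} (hf : Continuous f) (q : ℝ≥0∞) : MemLpLoc f q := by
  intro K hK
  have : IsFiniteMeasure (volume.restrict K) := ⟨by simpa using hK.measure_lt_top⟩
  obtain ⟨M, hM⟩ := hK.exists_bound_of_continuousOn hf.continuousOn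
  refine MemLp.of_bound hf.aestronglyMeasurable M ?_
  filter_upwards [ae_restrict_mem hK.measurableSet] with x hx using hM x hx

/-- Inserting `η ⋆ v` splits the error into a commutator, uniformly small on `K`, and a
mollification error of `v` in `L^q(K)`. -/
theorem tendstoLpLoc_fracDeriv_mollifiedCutoff {s : Side} {α : ℝ} (hα0 : 0 < α) (hα1 : α < 1)
    (hp1 : 1 ≤ p) (hp : p ≠ ⊤) (hq1 : 1 ≤ q) (hq : q ≠ ⊤) (hu : MemLp u p volume)
    (huv : IsWeakFracDeriv s α u v) (hv : MemLpLoc v q) (hψ : IsCutoffProfile ψ) :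
    TendstoLpLoc (fun j => fracDeriv s α (mollifiedCutoff ψ u (j + 1))) v q := by
  have hcont : ∀ j : ℕ, Continuous (fracDeriv s α (mollifiedCutoff ψ u (j + 1))) := fun j =>
    continuous_fracDeriv s hα1 (isTestFunction_mollifiedCutoff hψ hp1 hu j)
  refine ⟨fun j => memLpLoc_of_continuous (hcont j) q, hv, fun K hK => ?_⟩
  obtain ⟨R, hR⟩ := hK.isBounded.subset_closedBall 0
  set A := (Real.Gamma (1 - α))⁻¹ * α * (4 ^ (1 + α) * (1 + R) ^ (1 + α)) with hA
  have h1 := (tendsto_integral_truncation_sub_mul_weight (ψ := ψ) hα0 hp1 hp hu hψ).const_mul A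
  have hKm : volume.restrict K univ ^ q.toReal⁻¹ ≠ ⊤ := by
    refine ENNReal.rpow_ne_top_of_nonneg (by positivity) ?_
    rw [Measure.restrict_apply_univ]
    exact hK.measure_ne_top
  have h2 := ENNReal.Tendsto.const_mul (a := volume.restrict K univ ^ q.toReal⁻¹)
    (ENNReal.tendsto_ofReal h1) (Or.inr hKm)
  have h3 := h2.add (tendsto_eLpNorm_mollifier_convolution_restrict hq1 hq hv hK)
  rw [mul_zero, ENNReal.ofReal_zero, mul_zero, add_zero] at h3
  refine tendsto_of_tendsto_of_tendsto_of_le_of_le' tendsto_const_nhds h3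
    (Eventually.of_forall fun j => zero_le) ?_
  filter_upwards [eventually_ge_atTop ⌈R + 2⌉₊] with j hj
  have hjR : R + 2 ≤ j := (Nat.le_ceil _).trans (by exact_mod_cast hj)
  have hη : Continuous (mollifier (1 / ((j + 1 : ℕ) : ℝ)) ⋆ v) :=
    continuous_mollifier_convolution (by positivity) huv.1
  rw [← sub_add_sub_cancel _ (mollifier (1 / ((j + 1 : ℕ) : ℝ)) ⋆ v) v]
  refine (eLpNorm_add_le ((hcont j).sub hη).aestronglyMeasurable
    (hη.aestronglyMeasurable.sub (hv K hK).1) hq1).trans ?_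
  refine add_le_add_left (eLpNorm_le_of_ae_bound ?_) _
  filter_upwards [ae_restrict_mem hK.measurableSet] with x hx
  have hxR := hR hx
  rw [mem_closedBall_zero_iff, Real.norm_eq_abs] at hxR
  exact abs_fracDeriv_mollifiedCutoff_sub_le hα0 hα1 hp1 hu huv hψ hjR hxR

end MollifiedCutoff

end FracCalc



/-! ### The characterization theorem -/

theorem mainTheorem5 (s : FracCalc.Side) (α : ℝ) (hα0 : 0 < α) (hα1 : α < 1)
    (p q : ℝ≥0∞) (hp1 : 1 ≤ p) (hp : p ≠ (⊤ : ℝ≥0∞)) (hq1 : 1 ≤ q) (hq : q ≠ (⊤ : ℝ≥0∞))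
    (u : ℝ → ℝ) (hu : MemLp u p volume) (v : ℝ → ℝ) :
    ((FracCalc.IsWeakFracDeriv s α u v ∧ FracCalc.MemLpLoc v q) ↔
      ∃ U V : ℕ → ℝ → ℝ,
        (∀ j, FracCalc.IsTestFunction (U j)) ∧
        (∀ j, FracCalc.IsWeakFracDeriv s α (U j) (V j)) ∧
        Tendsto (fun j => eLpNorm (U j - u) p volume) atTop (𝓝 0) ∧
        FracCalc.TendstoLpLoc V v q) ∧
    (FracCalc.IsWeakFracDeriv s α u v ∧ FracCalc.MemLpLoc v q →
      ∀ ψ : ℝ → ℝ, FracCalc.IsCutoffProfile ψ →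
        (∀ j : ℕ, FracCalc.IsTestFunction (FracCalc.mollifiedCutoff ψ u (j + 1))) ∧
        Tendsto (fun j : ℕ => eLpNorm (FracCalc.mollifiedCutoff ψ u (j + 1) - u) p volume)
          atTop (𝓝 0) ∧
        ∃ V : ℕ → ℝ → ℝ,
          (∀ j, FracCalc.IsWeakFracDeriv s α (FracCalc.mollifiedCutoff ψ u (j + 1)) (V j)) ∧
          FracCalc.TendstoLpLoc V v q) := by
  have hb : FracCalc.IsWeakFracDeriv s α u v ∧ FracCalc.MemLpLoc v q →
      ∀ ψ : ℝ → ℝ, FracCalc.IsCutoffProfile ψ →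
        (∀ j : ℕ, FracCalc.IsTestFunction (FracCalc.mollifiedCutoff ψ u (j + 1))) ∧
        Tendsto (fun j : ℕ => eLpNorm (FracCalc.mollifiedCutoff ψ u (j + 1) - u) p volume)
          atTop (𝓝 0) ∧
        ∃ V : ℕ → ℝ → ℝ,
          (∀ j, FracCalc.IsWeakFracDeriv s α (FracCalc.mollifiedCutoff ψ u (j + 1)) (V j)) ∧
          FracCalc.TendstoLpLoc V v q := by
    rintro ⟨huv, hv⟩ ψ hψ
    have htest := FracCalc.isTestFunction_mollifiedCutoff hψ hp1 hu
    -- The witness for `V` is the classical derivative, which is a weak one by fractional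
    -- integration by parts.
    exact ⟨htest, FracCalc.tendsto_eLpNorm_mollifiedCutoff_sub hψ hp1 hp hu, _,
      fun j => FracCalc.isWeakFracDeriv_fracDeriv s hα1 (htest j),
      FracCalc.tendstoLpLoc_fracDeriv_mollifiedCutoff hα0 hα1 hp1 hp hq1 hq hu huv hv hψ⟩
  refine ⟨⟨fun h => ?_, ?_⟩, hb⟩
  · obtain ⟨ψ, hψ⟩ := FracCalc.exists_isCutoffProfile
    obtain ⟨h1, h2, V, h3, h4⟩ := hb h ψ hψ
    exact ⟨_, V, h1, h3, h2, h4⟩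
  · rintro ⟨U, V, hU, hUV, hUu, hVv⟩
    exact ⟨FracCalc.isWeakFracDeriv_of_tendsto s hα0 hα1 hp1 hq1 hu
      (fun j => (hU j).memLp p volume) hUV hUu hVv, hVv.2.1⟩
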